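/- Let $N\ge 1$ be the number of receive antennas (for dual-branch combining $N=2$), let $\lambda,d,\mathrm{SNR},T>0$ and $\alpha>2$ be real, and let $m_D\ge 1$ be an integer. For a real Nakagami parameter $m_I>0$ consider the following random variables: the points $\mathsf x_0,\mathsf x_1,\dots$ of a stationary Poisson point process $\Phi$ of density $\lambda$ in $\mathbb R^2$ (the interferer locations); for $1\le n\le N$ a gain $\mathsf g_n$, Gamma distributed with shape $m_D$ and scale $1/m_D$; and for $1\le n\le N$ and $i\ge 0$ a gain $\mathsf h_{n,i}$, Gamma distributed with shape $m_I$ and scale $1/m_I$. The locations are independent of the family of all gains. Put $$\mathsf I_n=d^{\alpha}\sum_{i}\mathsf h_{n,i}\,\|\mathsf x_i\|^{-\alpha},\qquad \mathrm{SINR}_{\mathrm{MRC}}=\sum_{n=1}^{N}\frac{\mathsf g_n}{\mathsf I_n+\mathrm{SNR}^{-1}} .$$ In the exact model all the gains $\mathsf g_n$, $\mathsf h_{n,i}$ are independent; let $\mathtt P_{\mathrm{MRC}}(m_I)=\mathbb P(\mathrm{SINR}_{\mathrm{MRC}}\ge T)$ be the success probability in this model. In the full-correlation (FC) model one has instead $\mathsf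 h_{1,i}=\dots=\mathsf h_{N,i}$ almost surely for every $i$ (so that $\mathsf I_1=\dots=\mathsf I_N$), and the $\mathsf g_n$ ($1\le n\le N$) and $\mathsf h_{1,i}$ ($i\ge 0$) are independent; let $\mathtt P^{\mathrm{FC}}_{\mathrm{MRC}}(m_I)=\mathbb P(\mathrm{SINR}_{\mathrm{MRC}}\ge T)$ be the success probability in this model. Then the exact and the FC model are asymptotically equivalent in terms of success probability as $m_I\to\infty$: there is a number $L>0$, depending only on $N,\lambda,d,\alpha,\mathrm{SNR},T,m_D$, such that $$\lim_{m_I\to\infty}\mathtt P_{\mathrm{MRC}}(m_I)=L=\lim_{m_I\to\infty}\mathtt P^{\mathrm{FC}}_{\mathrm{MRC}}(m_I),$$ for every choice of random variables realizing the two models. -/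

import Mathlib

open MeasureTheory ProbabilityTheory Filter Topology
open scoped ENNReal NNReal

namespace MRC

/-- The plane `ℝ²` with its Euclidean norm and Lebesgue measure. -/
abbrev Plane : Type := EuclideanSpace ℝ (Fin 2)

/-- The counting measure `∑ᵢ δ_{xᵢ}` of a sequence of points of the plane. -/
noncomputable def counting (x : ℕ → Plane) : Measure Plane :=
  Measure.sum fun i => Measure.dirac (x i)

/-- The random points `x₀, x₁, …` form a stationary Poisson point process of density `lam` on the
plane: the number of points in a Borel set `A` of finite area is Poisson distributed with mean
`lam * area A`, and the numbers of points in finitely many pairwise disjoint such sets are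
independent. -/
structure IsPoissonProcess {Ω : Type*} [MeasurableSpace Ω] (P : Measure Ω) (lam : ℝ)
    (x : ℕ → Ω → Plane) : Prop where
  measurable : ∀ i, Measurable (x i)
  count_law : ∀ A : Set Plane, MeasurableSet A → volume A ≠ ∞ →
    HasLaw (fun ω => counting (fun i => x i ω) A)
      ((poissonMeasure (ENNReal.ofReal lam * volume A).toNNReal).map (fun k : ℕ => (k : ℝ≥0∞))) P
  count_indep : ∀ (k : ℕ) (A : Fin k → Set Plane), (∀ j, MeasurableSet (A j)) →
    (∀ j, volume (A j) ≠ ∞) → Pairwise (Function.onFun Disjoint A) →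
    iIndepFun (fun j ω => counting (fun i => x i ω) (A j)) P

/-- The law of the power fading gain of a Nakagami fading channel with parameter `m`: the Gamma
distribution with shape `m` and scale `1 / m` (that is, rate `m`). -/
noncomputable def nakagamiGain (m : ℝ) : Measure ℝ := gammaMeasure m m

/-- What the exact and the full-correlation model with `N` antennas have in common. The interferers
`x i` form a stationary Poisson process of density `lam`; the gain `g n` of the desired link to
antenna `n` has Nakagami parameter `mD`; the gain `h n i` of the link from the `i`-th interferer to
antenna `n` has Nakagami parameter `mI`; the interferer locations are independent of all gains. -/
structure IsNetwork {Ω : Type*} [MeasurableSpace Ω] (P : Measure Ω) {N : ℕ} (lam mD mI : ℝ)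
    (x : ℕ → Ω → Plane) (g : Fin N → Ω → ℝ) (h : Fin N → ℕ → Ω → ℝ) : Prop where
  poisson : IsPoissonProcess P lam x
  g_law : ∀ n, HasLaw (g n) (nakagamiGain mD) P
  h_law : ∀ n i, HasLaw (h n i) (nakagamiGain mI) P
  indep_locations :
    IndepFun (fun ω i => x i ω) (fun ω => ((fun n => g n ω), (fun n i => h n i ω))) P

/-- The exact model: all the fading gains, over all links and all antennas, are independent. -/
structure IsExactModel {Ω : Type*} [MeasurableSpace Ω] (P : Measure Ω) {N : ℕ} (lam mD mI : ℝ)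
    (x : ℕ → Ω → Plane) (g : Fin N → Ω → ℝ) (h : Fin N → ℕ → Ω → ℝ) : Prop
    extends IsNetwork P lam mD mI x g h where
  indep_gains : iIndepFun (Sum.elim g (fun p : Fin N × ℕ => h p.1 p.2)) P

/-- The full-correlation (FC) model: the gains from a given interferer to the various antennas
coincide, and apart from this all the fading gains are independent. -/
structure IsFCModel {Ω : Type*} [MeasurableSpace Ω] (P : Measure Ω) {N : ℕ} (lam mD mI : ℝ)
    (x : ℕ → Ω → Plane) (g : Fin N → Ω → ℝ) (h : Fin N → ℕ → Ω → ℝ) : Prop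
    extends IsNetwork P lam mD mI x g h where
  h_eq : ∀ n n' i, h n i =ᵐ[P] h n' i
  indep_gains : ∀ n, iIndepFun (Sum.elim g (h n)) P

/-- The normalized interference power `d ^ α * ∑ᵢ hᵢ ‖xᵢ‖ ^ (-α)` at an antenna, as an element of
`[0, ∞]`, for given locations `x` and gains `h`. -/
noncomputable def interference (d α : ℝ) (x : ℕ → Plane) (h : ℕ → ℝ) : ℝ≥0∞ :=
  ENNReal.ofReal (d ^ α) * ∑' i, ENNReal.ofReal (h i) * ‖x i‖ₑ ^ (-α)

/-- The post-combiner SINR of maximal-ratio combining, `∑ₙ gₙ / (Iₙ + SNR⁻¹)`. -/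
noncomputable def sinr {N : ℕ} (d α SNR : ℝ) (x : ℕ → Plane) (g : Fin N → ℝ)
    (h : Fin N → ℕ → ℝ) : ℝ≥0∞ :=
  ∑ n, ENNReal.ofReal (g n) / (interference d α x (h n) + ENNReal.ofReal SNR⁻¹)

/-- The success probability `P (SINR ≥ T)`. -/
noncomputable def successProb {Ω : Type*} [MeasurableSpace Ω] (P : Measure Ω) {N : ℕ}
    (d α SNR T : ℝ) (x : ℕ → Ω → Plane) (g : Fin N → Ω → ℝ) (h : Fin N → ℕ → Ω → ℝ) : ℝ :=
  P.real {ω | ENNReal.ofReal T ≤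
    sinr d α SNR (fun i => x i ω) (fun n => g n ω) (fun n i => h n i ω)}

end MRC

namespace MRC

/-! As `mI → ∞` the interferer gains concentrate at their mean 1: the variance is `1 / mI`, so `E|h
- 1| ≤ 1 / √mI`. Every interference `Iₙ` thus approaches `b * S`, where `b = d ^ α` and `S = ∑ᵢ ‖xᵢ‖
^ (-α)`, and the SINR approaches `G / (b * S + c)`, where `G` is the total desired gain and `c` the
noise. The limit `L` is the probability of `T * (b * S + c) ≤ G`, with `G` and `S` independent.

The convergence `Iₙ → b * S` uses only the marginal laws of the interferer gains and their
independence from the locations, never their joint law over antennas or interferers; hence both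
models share the limit (`measure_lt_deviation_le`). An interference error of at most `δ` amounts to
a change of the noise by `δ`, so the success event is sandwiched between limiting events with noise
`c ± δ`. Their probability is continuous in the noise because `G` has no atoms
(`tendsto_prod_successSet`). It is positive because `G` is unbounded and `S` is almost surely
finite. Finally, the law of `S` depends on the density alone (`map_tsum_eq`), so `L` does not depend
on the realization. -/

/-! ### Moments, concentration and null sets of the gamma gain. -/

theorem integral_pow_gammaMeasure {a r : ℝ} (ha : 0 < a) (hr : 0 < r) (k : ℕ) :
    ∫ y, y ^ k ∂gammaMeasure a r = Real.Gamma (a + k) / (Real.Gamma a * r ^ k) := by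
  have h1 : ∫ y, y ^ k ∂gammaMeasure a r = ∫ y, gammaPDFReal a r y * y ^ k := by
    rw [gammaMeasure, integral_withDensity_eq_integral_toReal_smul₀]
    · refine integral_congr_ae (ae_of_all _ fun y => ?_)
      simp [gammaPDF, ENNReal.toReal_ofReal (gammaPDFReal_nonneg ha hr y)]
    · exact (measurable_gammaPDFReal a r).ennreal_ofReal.aemeasurable
    · exact ae_of_all _ fun y => ENNReal.ofReal_lt_top
  have h2 : ∫ y, gammaPDFReal a r y * y ^ k
      = ∫ y in Set.Ioi 0, r ^ a / Real.Gamma a * (y ^ (a + k - 1) * Real.exp (-(r * y))) := by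
    rw [← integral_Ici_eq_integral_Ioi, ← integral_indicator measurableSet_Ici,
      ← setIntegral_univ, ← setIntegral_univ (f := Set.indicator _ _)]
    have hne : ∀ᵐ y : ℝ, y ≠ 0 := by simp [ae_iff]
    refine integral_congr_ae ?_
    simp only [Measure.restrict_univ]
    filter_upwards [hne] with y hy
    by_cases h : 0 ≤ y
    · have hy' : 0 < y := lt_of_le_of_ne h hy.symm
      rw [Set.indicator_of_mem (Set.mem_Ici.2 h), gammaPDFReal, if_pos h,
        show a + k - 1 = (a - 1) + k by ring, Real.rpow_add hy', Real.rpow_natCast]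
      ring
    · rw [Set.indicator_of_notMem (by simpa using h), gammaPDFReal, if_neg h, zero_mul]
  rw [h1, h2, integral_const_mul, Real.integral_rpow_mul_exp_neg_mul_Ioi (by positivity) hr,
    Real.div_rpow zero_le_one hr.le, Real.one_rpow, Real.rpow_add hr, Real.rpow_natCast]
  have := (Real.rpow_pos_of_pos hr a).ne'
  field_simp

/-- The moment formula needs no integrability and its value is positive, whereas the integral of a
non-integrable function is 0 by convention. -/
theorem integrable_pow_gammaMeasure {a r : ℝ} (ha : 0 < a) (hr : 0 < r) (k : ℕ) :
    Integrable (fun y => y ^ k) (gammaMeasure a r) := by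
  by_contra h
  have h1 := integral_pow_gammaMeasure ha hr k
  rw [integral_undef h] at h1
  have := Real.Gamma_pos_of_pos (show 0 < a + k by positivity)
  have := Real.Gamma_pos_of_pos ha
  have : 0 < Real.Gamma (a + k) / (Real.Gamma a * r ^ k) := by positivity
  exact this.ne h1

theorem integral_sub_one_sq_nakagamiGain {m : ℝ} (hm : 0 < m) :
    Integrable (fun y => (y - 1) ^ 2) (nakagamiGain m) ∧
      ∫ y, (y - 1) ^ 2 ∂nakagamiGain m = m⁻¹ := by
  have := isProbabilityMeasure_gammaMeasure hm hm
  have i1 := integrable_pow_gammaMeasure hm hm 1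
  have i2 := integrable_pow_gammaMeasure hm hm 2
  have e1 := integral_pow_gammaMeasure hm hm 1
  have e2 := integral_pow_gammaMeasure hm hm 2
  have i3 : Integrable (fun _ : ℝ => (1 : ℝ)) (gammaMeasure m m) := integrable_const _
  have hG := Real.Gamma_pos_of_pos hm
  rw [Nat.cast_one, Real.Gamma_add_one hm.ne'] at e1
  rw [show m + ((2 : ℕ) : ℝ) = (m + 1) + 1 by push_cast; ring, Real.Gamma_add_one (by positivity),
    Real.Gamma_add_one hm.ne'] at e2
  have heq : (fun y : ℝ => (y - 1) ^ 2) = fun y => y ^ 2 - 2 * y ^ 1 + 1 := by ext; ring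
  have i12 : Integrable (fun y : ℝ => y ^ 2 - 2 * y ^ 1) (gammaMeasure m m) :=
    i2.sub (i1.const_mul 2)
  unfold nakagamiGain
  rw [heq]
  refine ⟨i12.add i3, ?_⟩
  rw [integral_add i12 i3, integral_sub i2 (i1.const_mul 2), integral_const_mul, e1, e2]
  simp
  field_simp
  ring

theorem lintegral_abs_sub_one_nakagamiGain_le {m : ℝ} (hm : 0 < m) :
    ∫⁻ y, ENNReal.ofReal |y - 1| ∂nakagamiGain m ≤ ENNReal.ofReal (√m)⁻¹ := by
  have : IsProbabilityMeasure (nakagamiGain m) := isProbabilityMeasure_gammaMeasure hm hm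
  obtain ⟨hi, he⟩ := integral_sub_one_sq_nakagamiGain hm
  have hs : 0 < √m := Real.sqrt_pos.2 hm
  have hss : √m * √m = m := Real.mul_self_sqrt hm.le
  calc ∫⁻ y, ENNReal.ofReal |y - 1| ∂nakagamiGain m
      ≤ ∫⁻ y, ENNReal.ofReal (2⁻¹ * (√m)⁻¹ + 2⁻¹ * √m * (y - 1) ^ 2) ∂nakagamiGain m := by
        refine lintegral_mono fun y => ENNReal.ofReal_le_ofReal ?_
        -- The AM-GM inequality, weighted by `√m` so that both terms integrate to `(√m)⁻¹ / 2`.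
        have h1 : 0 ≤ (√m * |y - 1| - 1) ^ 2 := sq_nonneg _
        have h2 : 2⁻¹ * (√m)⁻¹ + 2⁻¹ * √m * (y - 1) ^ 2 - |y - 1|
            = 2⁻¹ * (√m)⁻¹ * (√m * |y - 1| - 1) ^ 2 := by
          rw [← sq_abs (y - 1)]
          field_simp
          ring
        have : 0 ≤ 2⁻¹ * (√m)⁻¹ * (√m * |y - 1| - 1) ^ 2 := by positivity
        linarith
    _ = ENNReal.ofReal (∫ y, 2⁻¹ * (√m)⁻¹ + 2⁻¹ * √m * (y - 1) ^ 2 ∂nakagamiGain m) := by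
        rw [ofReal_integral_eq_lintegral_ofReal]
        · exact (integrable_const _).add (hi.const_mul _)
        · exact ae_of_all _ fun y => by positivity
    _ = ENNReal.ofReal (√m)⁻¹ := by
        rw [integral_add (integrable_const _) (hi.const_mul _),
          integral_const_mul (2⁻¹ * √m), he]
        congr 1
        simp only [integral_const, probReal_univ, smul_eq_mul, one_mul]
        nth_rw 3 [← hss]
        field_simp
        norm_num

theorem nakagamiGain_Iic_zero (m : ℝ) : nakagamiGain m (Set.Iic 0) = 0 := by
  rw [nakagamiGain, gammaMeasure, withDensity_apply _ measurableSet_Iic,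
    ← setLIntegral_congr Iio_ae_eq_Iic]
  exact lintegral_gammaPDF_of_nonpos le_rfl

theorem nakagamiGain_singleton (m y : ℝ) : nakagamiGain m {y} = 0 :=
  withDensity_absolutelyContinuous _ _ (measure_singleton y)

theorem nakagamiGain_Ici_pos {m : ℝ} (hm : 0 < m) (R : ℝ) : 0 < nakagamiGain m (Set.Ici R) := by
  rw [pos_iff_ne_zero, nakagamiGain, gammaMeasure, ne_eq, withDensity_apply_eq_zero]
  · intro h
    have hsub : Set.Ioi (max R 0) ⊆ {y | gammaPDF m m y ≠ 0} ∩ Set.Ici R := by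
      intro y hy
      have hy' := Set.mem_Ioi.1 hy
      refine ⟨?_, ((le_max_left _ _).trans_lt hy').le⟩
      have := gammaPDFReal_pos hm hm ((le_max_right _ _).trans_lt hy')
      simpa [gammaPDF] using this
    have := measure_mono_null hsub h
    simp at this
  · exact (measurable_gammaPDFReal m m).ennreal_ofReal

/-! ### Sums over the points of a Poisson process. -/

section Poisson

theorem lintegral_counting (x : ℕ → Plane) {f : Plane → ℝ≥0∞} (hf : Measurable f) :
    ∫⁻ y, f y ∂counting x = ∑' i, f (x i) := by
  simp [counting, lintegral_sum_measure, lintegral_dirac' _ hf]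

/-- The Poisson weights satisfy `(k + 1) * p (k + 1) = r * p k`; summing over `k` gives the mean. -/
theorem lintegral_poissonMeasure_natCast (r : ℝ≥0) :
    ∫⁻ k : ℕ, (k : ℝ≥0∞) ∂poissonMeasure r = r := by
  have h : ∀ k : ℕ, ((k + 1 : ℕ) : ℝ≥0∞) * poissonMeasure r {k + 1}
      = r * poissonMeasure r {k} := by
    intro k
    rw [poissonMeasure_singleton, poissonMeasure_singleton, ← ENNReal.ofReal_natCast,
      ← ENNReal.ofReal_coe_nnreal, ← ENNReal.ofReal_mul (by positivity),
      ← ENNReal.ofReal_mul (by positivity)]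
    congr 1
    rw [Nat.factorial_succ]
    push_cast
    field_simp
    ring
  rw [lintegral_countable', tsum_eq_zero_add' ENNReal.summable]
  simp_rw [h, ENNReal.tsum_mul_left]
  have h1 : ∑' k, poissonMeasure r {k} = 1 := by
    rw [← measure_univ (μ := poissonMeasure r), ← Measure.tsum_indicator_apply_singleton _ _
      MeasurableSet.univ]
    simp
  simp [h1]

variable {Ω : Type*} [MeasurableSpace Ω] {P : Measure Ω} {lam : ℝ} {x : ℕ → Ω → Plane}

theorem tendsto_map_iSup_Iic (P : Measure Ω) [IsFiniteMeasure P] {S : ℕ → Ω → ℝ≥0∞}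
    (hS : ∀ n, Measurable (S n)) (hmono : ∀ ω, Monotone fun n => S n ω) (a : ℝ≥0∞) :
    Tendsto (fun n => P.map (S n) (Set.Iic a)) atTop
      (𝓝 (P.map (fun ω => ⨆ n, S n ω) (Set.Iic a))) := by
  have hpre : (fun ω => ⨆ n, S n ω) ⁻¹' Set.Iic a = ⋂ n, S n ⁻¹' Set.Iic a := by
    ext ω
    simp
  rw [Measure.map_apply (Measurable.iSup hS) measurableSet_Iic, hpre]
  simp_rw [Measure.map_apply (hS _) measurableSet_Iic]
  exact tendsto_measure_iInter_atTop (fun n => (hS n measurableSet_Iic).nullMeasurableSet)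
    (fun m n hmn ω hω => (hmono ω hmn).trans hω) ⟨0, measure_ne_top _ _⟩

namespace IsPoissonProcess

theorem measurable_tsum (hx : IsPoissonProcess P lam x) {f : Plane → ℝ≥0∞} (hf : Measurable f) :
    Measurable fun ω => ∑' i, f (x i ω) :=
  Measurable.tsum fun i => hf.comp (hx.measurable i)

theorem lintegral_counting_apply (hx : IsPoissonProcess P lam x) {A : Set Plane}
    (hA : MeasurableSet A) (hfin : volume A ≠ ∞) :
    ∫⁻ ω, counting (fun i => x i ω) A ∂P = ENNReal.ofReal lam * volume A := by
  rw [(hx.count_law A hA hfin).lintegral_comp (f := fun a => a) aemeasurable_id',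
    lintegral_map measurable_id' (by fun_prop), lintegral_poissonMeasure_natCast,
    ENNReal.coe_toNNReal (ENNReal.mul_ne_top ENNReal.ofReal_ne_top hfin)]

theorem lintegral_tsum (hx : IsPoissonProcess P lam x) {f : Plane → ℝ≥0∞} (hf : Measurable f) :
    ∫⁻ ω, ∑' i, f (x i ω) ∂P = ∫⁻ y, f y ∂(Measure.sum fun i => P.map (x i)) := by
  simp_rw [lintegral_sum_measure, lintegral_map hf (hx.measurable _)]
  exact MeasureTheory.lintegral_tsum fun i => (hf.comp (hx.measurable i)).aemeasurable

theorem intensity_le (hx : IsPoissonProcess P lam x) :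
    (Measure.sum fun i => P.map (x i)) ≤ ENNReal.ofReal lam • (volume : Measure Plane) := by
  have key : ∀ A, MeasurableSet A → volume A ≠ ∞ →
      (Measure.sum fun i => P.map (x i)) A = ENNReal.ofReal lam * volume A := by
    intro A hA hfin
    rw [← hx.lintegral_counting_apply hA hfin, ← lintegral_indicator_one hA,
      ← hx.lintegral_tsum (measurable_one.indicator hA)]
    refine lintegral_congr fun ω => ?_
    rw [← lintegral_counting _ (measurable_one.indicator hA), lintegral_indicator_one hA]
  refine Measure.le_iff.2 fun A hA => ?_
  have hU : A = ⋃ n, A ∩ spanningSets (volume : Measure Plane) n := by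
    rw [← Set.inter_iUnion, iUnion_spanningSets, Set.inter_univ]
  have hmono : Monotone fun n => A ∩ spanningSets (volume : Measure Plane) n :=
    fun a b hab => Set.inter_subset_inter_right _ (monotone_spanningSets _ hab)
  conv_lhs => rw [hU]
  rw [hmono.measure_iUnion]
  refine iSup_le fun n => ?_
  rw [key _ (hA.inter (measurableSet_spanningSets _ n))
    ((measure_mono Set.inter_subset_right).trans_lt (measure_spanningSets_lt_top _ n)).ne]
  simp only [Measure.smul_apply, smul_eq_mul]
  gcongr
  exact Set.inter_subset_left

/-- Integrals of a truncated simple function against the counting measure have a law that does not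
depend on the Poisson process. -/
theorem map_setLIntegral_simpleFunc_eq [IsProbabilityMeasure P] (hx : IsPoissonProcess P lam x)
    {Ω' : Type*} [MeasurableSpace Ω'] {P' : Measure Ω'} [IsProbabilityMeasure P']
    {x' : ℕ → Ω' → Plane} (hx' : IsPoissonProcess P' lam x') (s : SimpleFunc Plane ℝ≥0∞)
    {B : Set Plane} (hB : MeasurableSet B) (hfin : volume B ≠ ∞) :
    P.map (fun ω => ∫⁻ y in B, s y ∂counting (fun i => x i ω))
      = P'.map (fun ω => ∫⁻ y in B, s y ∂counting (fun i => x' i ω)) := by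
  -- The fibres of `s` cut by `B` are disjoint and of finite area, so their counts have a joint law
  -- fixed by the definition of the process, and the integral is a linear function of them.
  let e := s.range.equivFin
  let A : Fin s.range.card → Set Plane := fun j => s ⁻¹' {(e.symm j : ℝ≥0∞)} ∩ B
  have hA : ∀ j, MeasurableSet (A j) := fun j => (s.measurableSet_fiber _).inter hB
  have hAfin : ∀ j, volume (A j) ≠ ∞ := fun j =>
    ((measure_mono Set.inter_subset_right).trans_lt hfin.lt_top).ne
  have hdisj : Pairwise (Function.onFun Disjoint A) := by
    intro i j hij
    refine Set.disjoint_left.2 fun y hy hy' => hij ?_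
    have : (e.symm i : ℝ≥0∞) = e.symm j := by
      rw [← show s y = e.symm i from hy.1, ← show s y = e.symm j from hy'.1]
    exact e.symm.injective (Subtype.ext this)
  let F : (Fin s.range.card → ℝ≥0∞) → ℝ≥0∞ := fun v => ∑ j, (e.symm j : ℝ≥0∞) * v j
  have hF : Measurable F := by fun_prop
  have hint : ∀ z : ℕ → Plane, ∫⁻ y in B, s y ∂counting z = F fun j => counting z (A j) := by
    intro z
    rw [SimpleFunc.lintegral_eq_lintegral, SimpleFunc.lintegral, ← Finset.sum_coe_sort,
      ← e.symm.sum_comp]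
    refine Finset.sum_congr rfl fun j _ => ?_
    rw [Measure.restrict_apply (s.measurableSet_fiber _)]
  simp_rw [hint]
  have h1 := (hx.count_indep _ A hA hAfin hdisj).hasLaw_pi
    fun j => hx.count_law (A j) (hA j) (hAfin j)
  have h2 := (hx'.count_indep _ A hA hAfin hdisj).hasLaw_pi
    fun j => hx'.count_law (A j) (hA j) (hAfin j)
  have e1 := AEMeasurable.map_map_of_aemeasurable hF.aemeasurable h1.aemeasurable
  have e2 := AEMeasurable.map_map_of_aemeasurable hF.aemeasurable h2.aemeasurable
  rw [h1.map_eq] at e1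
  rw [h2.map_eq] at e2
  exact e1.symm.trans e2

/-- The law of a sum over the points of a Poisson process depends only on the density. -/
theorem map_tsum_eq [IsProbabilityMeasure P] (hx : IsPoissonProcess P lam x)
    {Ω' : Type*} [MeasurableSpace Ω'] {P' : Measure Ω'} [IsProbabilityMeasure P']
    {x' : ℕ → Ω' → Plane} (hx' : IsPoissonProcess P' lam x') {f : Plane → ℝ≥0∞}
    (hf : Measurable f) :
    P.map (fun ω => ∑' i, f (x i ω)) = P'.map (fun ω => ∑' i, f (x' i ω)) := by
  -- Truncated simple functions increase to `f`, so the sums increase too, and the values of their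
  -- laws on each `Set.Iic a` converge.
  let B := spanningSets (volume : Measure Plane)
  let s := SimpleFunc.eapprox f
  let fn : ℕ → Plane → ℝ≥0∞ := fun n => (B n).indicator (s n)
  have hBm : ∀ n, MeasurableSet (B n) := measurableSet_spanningSets _
  have hfn : ∀ n, Measurable (fn n) := fun n => (s n).measurable.indicator (hBm n)
  have hmono : Monotone fn := by
    intro a b hab y
    by_cases hy : y ∈ B a
    · have hy' : y ∈ B b := monotone_spanningSets _ hab hy
      simp only [fn, Set.indicator_of_mem hy, Set.indicator_of_mem hy']
      exact SimpleFunc.monotone_eapprox f hab y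
    · simp [fn, Set.indicator_of_notMem hy]
  have hsup : ∀ y, ⨆ n, fn n y = f y := by
    intro y
    rw [← SimpleFunc.iSup_eapprox_apply hf y]
    refine le_antisymm (iSup_mono fun n => Set.indicator_le_self _ _ y) (iSup_le fun n => ?_)
    have hy : y ∈ ⋃ n, B n := by simp [B, iUnion_spanningSets]
    obtain ⟨k, hk⟩ := Set.mem_iUnion.1 hy
    refine le_trans ?_ (le_iSup _ (max n k))
    have hk' : y ∈ B (max n k) := monotone_spanningSets _ (le_max_right n k) hk
    simp only [fn, Set.indicator_of_mem hk']
    exact SimpleFunc.monotone_eapprox f (le_max_left n k) y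
  have hS : ∀ z : ℕ → Plane, ∑' i, f (z i) = ⨆ n, ∫⁻ y in B n, s n y ∂counting z := by
    intro z
    rw [← lintegral_counting z hf, ← funext hsup, lintegral_iSup hfn hmono]
    simp_rw [fn, lintegral_indicator (hBm _)]
  have hSn : ∀ n (z : ℕ → Plane), ∫⁻ y in B n, s n y ∂counting z = ∑' i, fn n (z i) := by
    intro n z
    rw [← lintegral_counting z (hfn n), ← lintegral_indicator (hBm n)]
  have hSm : ∀ z : ℕ → Plane, Monotone fun n => ∫⁻ y in B n, s n y ∂counting z := by
    intro z a b hab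
    simp only [← lintegral_indicator (hBm _)]
    exact lintegral_mono (hmono hab)
  have := Measure.isProbabilityMeasure_map (μ := P) (hx.measurable_tsum hf).aemeasurable
  have := Measure.isProbabilityMeasure_map (μ := P') (hx'.measurable_tsum hf).aemeasurable
  have t1 := fun a => tendsto_map_iSup_Iic P
    (S := fun n ω => ∫⁻ y in B n, s n y ∂counting (fun i => x i ω))
    (fun n => by
      simp_rw [hSn]
      exact hx.measurable_tsum (hfn n)) (fun ω => hSm _) a
  have t2 := fun a => tendsto_map_iSup_Iic P'
    (S := fun n ω => ∫⁻ y in B n, s n y ∂counting (fun i => x' i ω))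
    (fun n => by
      simp_rw [hSn]
      exact hx'.measurable_tsum (hfn n)) (fun ω => hSm _) a
  refine Measure.ext_of_Iic _ _ fun a => ?_
  simp_rw [hS]
  refine tendsto_nhds_unique (t1 a) ((t2 a).congr fun n => ?_)
  rw [hx.map_setLIntegral_simpleFunc_eq hx' (s n) (hBm n) (measure_spanningSets_lt_top _ n).ne]

end IsPoissonProcess

theorem measurable_enorm_rpow (α : ℝ) : Measurable fun y : Plane => ‖y‖ₑ ^ (-α) := by
  fun_prop

theorem setLIntegral_enorm_rpow_lt_top {α : ℝ} (hα : 2 < α) :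
    ∫⁻ y : Plane, {y | 1 ≤ ‖y‖}.indicator (fun y => ‖y‖ₑ ^ (-α)) y < ∞ := by
  have hfin := finite_integral_one_add_norm (E := Plane) (μ := volume) (r := α) (by simpa using hα)
  refine lt_of_le_of_lt ?_ (ENNReal.mul_lt_top (ENNReal.ofReal_lt_top (r := 2 ^ α)) hfin)
  rw [← lintegral_const_mul' _ _ ENNReal.ofReal_ne_top]
  refine lintegral_mono fun y => ?_
  by_cases hy : y ∈ {y : Plane | 1 ≤ ‖y‖}
  swap
  · simp only [Set.indicator_of_notMem hy, zero_le]
  rw [Set.indicator_of_mem hy]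
  have hy' : 1 ≤ ‖y‖ := hy
  have hy0 : 0 < ‖y‖ := by linarith
  rw [← ofReal_norm, ENNReal.ofReal_rpow_of_pos hy0,
    ← ENNReal.ofReal_mul (by positivity)]
  refine ENNReal.ofReal_le_ofReal ?_
  -- The factor `2 ^ α` comes from `1 + ‖y‖ ≤ 2 * ‖y‖` for `1 ≤ ‖y‖`.
  rw [Real.rpow_neg hy0.le, Real.rpow_neg (by positivity), ← div_eq_mul_inv,
    ← Real.div_rpow (by norm_num) (by positivity), ← Real.inv_rpow hy0.le]
  refine Real.rpow_le_rpow (by positivity) ?_ (by linarith)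
  rw [inv_eq_one_div, div_le_div_iff₀ hy0 (by positivity)]
  linarith

theorem finite_of_counting_ne_top {z : ℕ → Plane} {A : Set Plane} (hA : MeasurableSet A)
    (h : counting z A ≠ ∞) : {i | z i ∈ A}.Finite := by
  rw [← lintegral_indicator_one hA, lintegral_counting _ (measurable_one.indicator hA)] at h
  refine (ENNReal.finite_const_le_of_tsum_ne_top h one_ne_zero).subset fun i hi => ?_
  have hi' : z i ∈ A := hi
  simp [Set.indicator_of_mem hi']

/-- The mean is no help near the origin, where `‖y‖ ^ (-α)` is not integrable. The far points
contribute a sum of finite mean since `α > 2`; the unit ball holds finitely many points, none of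
them at 0. -/
theorem IsPoissonProcess.ae_tsum_enorm_rpow_ne_top (hx : IsPoissonProcess P lam x)
    {α : ℝ} (hα : 2 < α) : ∀ᵐ ω ∂P, ∑' i, ‖x i ω‖ₑ ^ (-α) ≠ ∞ := by
  have hfar : MeasurableSet {y : Plane | 1 ≤ ‖y‖} := measurableSet_le (by fun_prop) (by fun_prop)
  have hmeas := measurable_enorm_rpow α
  have h1 : ∀ᵐ ω ∂P, ∑' i, {y | 1 ≤ ‖y‖}.indicator (fun y => ‖y‖ₑ ^ (-α)) (x i ω) < ∞ := by
    refine ae_lt_top (hx.measurable_tsum (hmeas.indicator hfar)) (ne_of_lt ?_)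
    rw [hx.lintegral_tsum (hmeas.indicator hfar)]
    refine (lintegral_mono' hx.intensity_le le_rfl).trans_lt ?_
    rw [lintegral_smul_measure]
    exact ENNReal.mul_lt_top ENNReal.ofReal_lt_top (setLIntegral_enorm_rpow_lt_top hα)
  have hcount : ∀ A : Set Plane, MeasurableSet A →
      Measurable fun ω => counting (fun i => x i ω) A := by
    intro A hA
    simp_rw [← lintegral_indicator_one hA, lintegral_counting _ (measurable_one.indicator hA)]
    exact hx.measurable_tsum (measurable_one.indicator hA)
  have hball : volume (Metric.ball (0 : Plane) 1) ≠ ∞ := measure_ball_lt_top.ne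
  have h2 : ∀ᵐ ω ∂P, counting (fun i => x i ω) (Metric.ball 0 1) < ∞ := by
    refine ae_lt_top (hcount _ measurableSet_ball) ?_
    rw [hx.lintegral_counting_apply measurableSet_ball hball]
    exact ENNReal.mul_ne_top ENNReal.ofReal_ne_top hball
  have h3 : ∀ᵐ ω ∂P, counting (fun i => x i ω) {0} = 0 := by
    refine (lintegral_eq_zero_iff (hcount _ (measurableSet_singleton 0))).1 ?_
    rw [hx.lintegral_counting_apply (measurableSet_singleton 0) (by simp)]
    simp
  filter_upwards [h1, h2, h3] with ω h1 h2 h3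
  have hne : ∀ i, x i ω ≠ 0 := by
    intro i hi
    rw [← lintegral_indicator_one (measurableSet_singleton 0),
      lintegral_counting _ (measurable_one.indicator (measurableSet_singleton 0)),
      ENNReal.tsum_eq_zero] at h3
    simpa [hi] using h3 i
  have hsplit : ∀ i, ‖x i ω‖ₑ ^ (-α) = {y | 1 ≤ ‖y‖}.indicator (fun y => ‖y‖ₑ ^ (-α)) (x i ω)
      + {y | 1 ≤ ‖y‖}ᶜ.indicator (fun y => ‖y‖ₑ ^ (-α)) (x i ω) := fun i =>
    (congrFun (Set.indicator_self_add_compl {y : Plane | 1 ≤ ‖y‖} fun y => ‖y‖ₑ ^ (-α)) _).symm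
  simp_rw [hsplit]
  rw [ENNReal.tsum_add]
  refine ENNReal.add_ne_top.2 ⟨h1.ne, ?_⟩
  have hfin := finite_of_counting_ne_top measurableSet_ball h2.ne
  rw [tsum_eq_sum (s := hfin.toFinset)]
  · refine (ENNReal.sum_lt_top.2 fun i _ => ?_).ne
    refine lt_of_le_of_lt (Set.indicator_le_self _ _ _) ?_
    rw [ENNReal.rpow_neg, ENNReal.inv_lt_top]
    exact ENNReal.rpow_pos (by simpa using hne i) enorm_ne_top
  · intro i hi
    refine Set.indicator_of_notMem (fun h => hi ?_) _
    simpa using h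

end Poisson

/-! ### The total desired gain: no atoms, unbounded support. -/

theorem measurable_sum_ofReal (N : ℕ) :
    Measurable fun γ : Fin N → ℝ => ∑ n, ENNReal.ofReal (γ n) := by
  fun_prop

/-- The law of the total gain of the desired links. -/
noncomputable def totalGainLaw (N : ℕ) (m : ℝ) : Measure ℝ≥0∞ :=
  (Measure.pi fun _ : Fin N => nakagamiGain m).map fun γ => ∑ n, ENNReal.ofReal (γ n)

theorem isProbabilityMeasure_nakagamiGain {m : ℝ} (hm : 0 < m) :
    IsProbabilityMeasure (nakagamiGain m) := isProbabilityMeasure_gammaMeasure hm hm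

theorem isProbabilityMeasure_totalGainLaw (N : ℕ) {m : ℝ} (hm : 0 < m) :
    IsProbabilityMeasure (totalGainLaw N m) := by
  have := isProbabilityMeasure_nakagamiGain hm
  exact Measure.isProbabilityMeasure_map (measurable_sum_ofReal N).aemeasurable

theorem nakagamiGain_ofReal_add_eq (m : ℝ) {a : ℝ≥0∞} (ha' : a ≠ ∞) (r : ℝ≥0∞) :
    nakagamiGain m {y | ENNReal.ofReal y + r = a} = 0 := by
  refine measure_mono_null (t := Set.Iic 0 ∪ {(a - r).toReal}) (fun y hy => ?_)
    (measure_union_null (nakagamiGain_Iic_zero m) (nakagamiGain_singleton m _))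
  rcases le_or_gt y 0 with h | h
  · exact Or.inl h
  · right
    have hr : r ≠ ∞ := by
      rintro rfl
      exact ha' (by simpa using hy.symm)
    rw [Set.mem_singleton_iff, ← show ENNReal.ofReal y + r = a from hy,
      ENNReal.add_sub_cancel_right hr, ENNReal.toReal_ofReal h.le]

/-- With all gains but the first fixed, the sum hits `a` only if the first gain is nonpositive or
equals one given number, and both are null events. -/
theorem totalGainLaw_singleton {N : ℕ} (hN : 1 ≤ N) {m : ℝ} (hm : 0 < m) (a : ℝ≥0∞) :
    totalGainLaw N m {a} = 0 := by
  have := isProbabilityMeasure_nakagamiGain hm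
  obtain ⟨n, rfl⟩ : ∃ n, N = n + 1 := ⟨N - 1, by omega⟩
  rw [totalGainLaw, Measure.map_apply (measurable_sum_ofReal _) (measurableSet_singleton a)]
  rcases eq_or_ne a ∞ with rfl | ha'
  · convert measure_empty (μ := Measure.pi fun _ : Fin (n + 1) => nakagamiGain m)
    ext γ
    simp [ENNReal.sum_eq_top]
  let E : Set (ℝ × (Fin n → ℝ)) := {p | ENNReal.ofReal p.1 + ∑ j, ENNReal.ofReal (p.2 j) = a}
  have hE : MeasurableSet E := measurableSet_eq_fun (by fun_prop) (by fun_prop)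
  have hmp : MeasurePreserving (MeasurableEquiv.piFinSuccAbove (fun _ : Fin (n + 1) => ℝ) 0)
      (Measure.pi fun _ => nakagamiGain m)
      ((nakagamiGain m).prod (Measure.pi fun _ : Fin n => nakagamiGain m)) :=
    measurePreserving_piFinSuccAbove (fun _ : Fin (n + 1) => nakagamiGain m) 0
  have hpre : (fun γ : Fin (n + 1) → ℝ => ∑ k, ENNReal.ofReal (γ k)) ⁻¹' {a}
      = (MeasurableEquiv.piFinSuccAbove (fun _ : Fin (n + 1) => ℝ) 0) ⁻¹' E := by
    ext γ
    rw [Set.mem_preimage, Fin.sum_univ_succ]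
    rfl
  have hE0 : ((nakagamiGain m).prod (Measure.pi fun _ : Fin n => nakagamiGain m)) E = 0 := by
    rw [Measure.prod_apply_symm hE,
      lintegral_eq_zero_iff (measurable_measure_prodMk_right hE)]
    exact ae_of_all _ fun v => nakagamiGain_ofReal_add_eq m ha' (∑ j, ENNReal.ofReal (v j))
  rw [hpre, hmp.measure_preimage hE.nullMeasurableSet, hE0]

theorem totalGainLaw_Ici_pos {N : ℕ} (hN : 1 ≤ N) {m : ℝ} (hm : 0 < m) {R : ℝ≥0∞} (hR : R ≠ ∞) :
    0 < totalGainLaw N m (Set.Ici R) := by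
  have := isProbabilityMeasure_nakagamiGain hm
  rw [totalGainLaw, Measure.map_apply (measurable_sum_ofReal N) measurableSet_Ici]
  have h0 : 0 < Measure.pi (fun _ : Fin N => nakagamiGain m)
      (Set.univ.pi fun _ => Set.Ici R.toReal) := by
    rw [Measure.pi_pi]
    exact CanonicallyOrderedAdd.prod_pos.2 fun _ _ => nakagamiGain_Ici_pos hm _
  refine h0.trans_le (measure_mono fun γ hγ => ?_)
  have h1 := hγ ⟨0, hN⟩ trivial
  calc R = ENNReal.ofReal R.toReal := (ENNReal.ofReal_toReal hR).symm
    _ ≤ ENNReal.ofReal (γ ⟨0, hN⟩) := ENNReal.ofReal_le_ofReal h1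
    _ ≤ ∑ n, ENNReal.ofReal (γ n) :=
      Finset.single_le_sum (f := fun n => ENNReal.ofReal (γ n)) (fun _ _ => zero_le)
        (Finset.mem_univ _)

/-! ### The limiting success event. -/

/-- Total gain `p.1` and interference `p.2` for which maximal-ratio combining, with common
interference at all antennas and noise power `c`, reaches the threshold `t`. -/
def successSet (b t c : ℝ≥0∞) : Set (ℝ≥0∞ × ℝ≥0∞) := {p | t * (b * p.2 + c) ≤ p.1}

theorem measurableSet_successSet (b t c : ℝ≥0∞) : MeasurableSet (successSet b t c) :=
  measurableSet_le (by fun_prop) (by fun_prop)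

/-- The indicators converge off the boundary `p.1 = t * (b * p.2 + c)`, each section of which is an
atom of the total gain, hence null. -/
theorem tendsto_prod_successSet {N : ℕ} (hN : 1 ≤ N) {m : ℝ} (hm : 0 < m) (μ : Measure ℝ≥0∞)
    [IsProbabilityMeasure μ] (b : ℝ≥0∞) {t : ℝ≥0∞} (ht : t ≠ ∞) (c : ℝ≥0∞) :
    Tendsto (fun c' => ((totalGainLaw N m).prod μ) (successSet b t c')) (𝓝 c)
      (𝓝 (((totalGainLaw N m).prod μ) (successSet b t c))) := by
  have := isProbabilityMeasure_totalGainLaw N hm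
  refine tendsto_measure_of_ae_tendsto_indicator_of_isFiniteMeasure _
    (measurableSet_successSet _ _ _) (fun _ => measurableSet_successSet _ _ _) ?_
  have hnull : ∀ᵐ p ∂(totalGainLaw N m).prod μ, p.1 ≠ t * (b * p.2 + c) := by
    have hE : MeasurableSet {p : ℝ≥0∞ × ℝ≥0∞ | p.1 = t * (b * p.2 + c)} :=
      measurableSet_eq_fun (by fun_prop) (by fun_prop)
    rw [ae_iff]
    simp only [ne_eq, not_not]
    rw [Measure.prod_apply_symm hE, lintegral_eq_zero_iff (measurable_measure_prodMk_right hE)]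
    exact ae_of_all _ fun s => totalGainLaw_singleton hN hm (t * (b * s + c))
  filter_upwards [hnull] with p hp
  have hlim : Tendsto (fun c' => t * (b * p.2 + c')) (𝓝 c) (𝓝 (t * (b * p.2 + c))) :=
    ENNReal.Tendsto.const_mul (tendsto_const_nhds.add tendsto_id) (Or.inr ht)
  rcases lt_or_gt_of_ne hp with h | h
  · filter_upwards [hlim.eventually (lt_mem_nhds h)] with c' hc'
    simp [successSet, not_le.2 h, not_le.2 hc']
  · filter_upwards [hlim.eventually (gt_mem_nhds h)] with c' hc'
    simp [successSet, le_of_lt h, le_of_lt hc']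

theorem prod_successSet_pos {N : ℕ} (hN : 1 ≤ N) {m : ℝ} (hm : 0 < m) (μ : Measure ℝ≥0∞)
    [IsProbabilityMeasure μ] (hμ : ∀ᵐ s ∂μ, s ≠ ∞) {b t c : ℝ≥0∞} (hb : b ≠ ∞) (ht : t ≠ ∞)
    (hc : c ≠ ∞) : 0 < ((totalGainLaw N m).prod μ) (successSet b t c) := by
  have := isProbabilityMeasure_totalGainLaw N hm
  rw [pos_iff_ne_zero, ne_eq, Measure.prod_apply_symm (measurableSet_successSet _ _ _),
    lintegral_eq_zero_iff (measurable_measure_prodMk_right (measurableSet_successSet _ _ _))]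
  intro h
  have hfalse : ∀ᵐ _ ∂μ, False := by
    filter_upwards [h, hμ] with s hs hs'
    exact (totalGainLaw_Ici_pos hN hm (ENNReal.mul_ne_top ht
      (ENNReal.add_ne_top.2 ⟨ENNReal.mul_ne_top hb hs', hc⟩))).ne' hs
  simp at hfalse
  exact IsProbabilityMeasure.ne_zero μ hfalse

/-! ### Deterministic sandwich of the SINR. -/

/-- Distance of the interference from its value without fading, bounded term by term. -/
noncomputable def deviation (d α : ℝ) (x : ℕ → Plane) (h : ℕ → ℝ) : ℝ≥0∞ :=
  ENNReal.ofReal (d ^ α) * ∑' i, ENNReal.ofReal |h i - 1| * ‖x i‖ₑ ^ (-α)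

theorem interference_le (d α : ℝ) (x : ℕ → Plane) (h : ℕ → ℝ) :
    interference d α x h
      ≤ ENNReal.ofReal (d ^ α) * ∑' i, ‖x i‖ₑ ^ (-α) + deviation d α x h := by
  rw [interference, deviation, ← mul_add, ← ENNReal.tsum_add]
  gcongr with i
  rw [← one_add_mul, ← ENNReal.ofReal_one, ← ENNReal.ofReal_add zero_le_one (abs_nonneg _)]
  gcongr
  linarith [le_abs_self (h i - 1)]

theorem le_interference_add (d α : ℝ) (x : ℕ → Plane) (h : ℕ → ℝ) :
    ENNReal.ofReal (d ^ α) * ∑' i, ‖x i‖ₑ ^ (-α)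
      ≤ interference d α x h + deviation d α x h := by
  rw [interference, deviation, ← mul_add, ← ENNReal.tsum_add]
  gcongr with i
  rw [← add_mul]
  refine le_mul_of_one_le_left zero_le ?_
  rw [← ENNReal.ofReal_one]
  refine (ENNReal.ofReal_le_ofReal ?_).trans ENNReal.ofReal_add_le
  linarith [neg_abs_le (h i - 1)]

/-- The deviation is absorbed into the noise: lowering the noise by `δ` makes up for replacing each
interference by its value without fading. The converse bound below raises the noise by `δ`. -/
theorem mem_successSet_of_le_sinr {N : ℕ} {d α SNR : ℝ} {x : ℕ → Plane} {g : Fin N → ℝ}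
    {h : Fin N → ℕ → ℝ} {t c' δ : ℝ≥0∞} (hc : ENNReal.ofReal SNR⁻¹ = c' + δ)
    (hD : ∀ n, deviation d α x (h n) ≤ δ) (ht : t ≤ sinr d α SNR x g h) :
    (∑ n, ENNReal.ofReal (g n), ∑' i, ‖x i‖ₑ ^ (-α))
      ∈ successSet (ENNReal.ofReal (d ^ α)) t c' := by
  refine ENNReal.mul_le_of_le_div (ht.trans ?_)
  rw [sinr, div_eq_mul_inv, Finset.sum_mul]
  refine Finset.sum_le_sum fun n _ => ?_
  rw [div_eq_mul_inv, hc]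
  refine mul_le_mul_right (ENNReal.inv_le_inv.2 ?_) _
  calc _ ≤ interference d α x (h n) + deviation d α x (h n) + c' := by
        gcongr
        exact le_interference_add d α x (h n)
    _ ≤ interference d α x (h n) + δ + c' := by
        gcongr
        exact hD n
    _ = _ := by ring

theorem le_sinr_of_mem_successSet {N : ℕ} {d α SNR : ℝ} {x : ℕ → Plane} {g : Fin N → ℝ}
    {h : Fin N → ℕ → ℝ} {t c' δ : ℝ≥0∞} (hc : c' = ENNReal.ofReal SNR⁻¹ + δ) (hc0 : c' ≠ 0)
    (hD : ∀ n, deviation d α x (h n) ≤ δ)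
    (hmem : (∑ n, ENNReal.ofReal (g n), ∑' i, ‖x i‖ₑ ^ (-α))
      ∈ successSet (ENNReal.ofReal (d ^ α)) t c') :
    t ≤ sinr d α SNR x g h := by
  have hG : ∑ n, ENNReal.ofReal (g n) ≠ ∞ := ENNReal.sum_ne_top.2 fun _ _ => ENNReal.ofReal_ne_top
  refine ((ENNReal.le_div_iff_mul_le (Or.inl (by simp [hc0])) (Or.inr hG)).2 hmem).trans ?_
  rw [sinr, div_eq_mul_inv, Finset.sum_mul]
  refine Finset.sum_le_sum fun n _ => ?_
  rw [div_eq_mul_inv, hc]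
  refine mul_le_mul_right (ENNReal.inv_le_inv.2 ?_) _
  calc _ ≤ ENNReal.ofReal (d ^ α) * ∑' i, ‖x i‖ₑ ^ (-α) + deviation d α x (h n)
          + ENNReal.ofReal SNR⁻¹ := by
        gcongr
        exact interference_le d α x (h n)
    _ ≤ ENNReal.ofReal (d ^ α) * ∑' i, ‖x i‖ₑ ^ (-α) + δ + ENNReal.ofReal SNR⁻¹ := by
        gcongr
        exact hD n
    _ = _ := by ring

theorem measurable_tsum_enorm_rpow (α : ℝ) :
    Measurable fun y : ℕ → Plane => ∑' i, ‖y i‖ₑ ^ (-α) :=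
  Measurable.tsum fun i => (measurable_enorm_rpow α).comp (measurable_pi_apply i)

/-! ### Probability estimates common to both models. -/

namespace IsNetwork

variable {Ω : Type*} [MeasurableSpace Ω] {P : Measure Ω} [IsProbabilityMeasure P] {N : ℕ}
  {lam mD mI : ℝ} {x : ℕ → Ω → Plane} {g : Fin N → Ω → ℝ} {h : Fin N → ℕ → Ω → ℝ}

theorem measure_mem_successSet (H : IsNetwork P lam mD mI x g h) (hg : iIndepFun g P)
    (α : ℝ) (b t c : ℝ≥0∞) :
    P {ω | (∑ n, ENNReal.ofReal (g n ω), ∑' i, ‖x i ω‖ₑ ^ (-α)) ∈ successSet b t c}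
      = ((totalGainLaw N mD).prod (P.map fun ω => ∑' i, ‖x i ω‖ₑ ^ (-α))) (successSet b t c) := by
  have hlaw := hg.hasLaw_pi H.g_law
  have hsum := measurable_sum_ofReal N
  have hGm : AEMeasurable (fun ω => ∑ n, ENNReal.ofReal (g n ω)) P :=
    hsum.comp_aemeasurable hlaw.aemeasurable
  have hSm := H.poisson.measurable_tsum (measurable_enorm_rpow α)
  have hind : IndepFun (fun ω => ∑ n, ENNReal.ofReal (g n ω)) (fun ω => ∑' i, ‖x i ω‖ₑ ^ (-α)) P :=
    H.indep_locations.symm.comp (φ := fun p : (Fin N → ℝ) × (Fin N → ℕ → ℝ) => ∑ n, ENNReal.ofReal (p.1 n))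
      (hsum.comp measurable_fst) (measurable_tsum_enorm_rpow α)
  have hmap := (indepFun_iff_map_prod_eq_prod_map_map hGm hSm.aemeasurable).1 hind
  have hG : P.map (fun ω => ∑ n, ENNReal.ofReal (g n ω)) = totalGainLaw N mD := by
    have := AEMeasurable.map_map_of_aemeasurable hsum.aemeasurable hlaw.aemeasurable
    rw [hlaw.map_eq] at this
    exact this.symm
  rw [hG] at hmap
  rw [← hmap, Measure.map_apply_of_aemeasurable (hGm.prodMk hSm.aemeasurable)
    (measurableSet_successSet _ _ _)]
  rfl

/-- Markov's inequality on the event `S ≤ K`, where `S` is the path-loss sum. The truncation is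
needed since `S` may have infinite mean; as it involves only the locations, each truncated weight `w
i` remains independent of the gain `h n i`. -/
theorem measure_lt_deviation_le (H : IsNetwork P lam mD mI x g h) (hmI : 0 < mI) (d α : ℝ)
    (n : Fin N) {δ : ℝ≥0∞} (hδ : δ ≠ 0) (hδ' : δ ≠ ∞) (K : ℝ≥0∞) :
    P {ω | δ < deviation d α (fun i => x i ω) (fun i => h n i ω)}
      ≤ (P.map fun ω => ∑' i, ‖x i ω‖ₑ ^ (-α)) (Set.Ioi K)
        + ENNReal.ofReal (√mI)⁻¹ * (ENNReal.ofReal (d ^ α) * K) / δ := by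
  let b := ENNReal.ofReal (d ^ α)
  let w : ℕ → (ℕ → Plane) → ℝ≥0∞ := fun i =>
    {y | ∑' j, ‖y j‖ₑ ^ (-α) ≤ K}.indicator fun y => b * ‖y i‖ₑ ^ (-α)
  have hSm := H.poisson.measurable_tsum (measurable_enorm_rpow α)
  have hw : ∀ i, Measurable (w i) := fun i =>
    (((measurable_enorm_rpow α).comp (measurable_pi_apply i)).const_mul b).indicator
      (measurable_tsum_enorm_rpow α measurableSet_Iic)
  have hx : Measurable fun ω i => x i ω := measurable_pi_lambda _ H.poisson.measurable
  have habs : Measurable fun y : ℝ => ENNReal.ofReal |y - 1| := by fun_prop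
  have hf : ∀ i, AEMeasurable (fun ω => ENNReal.ofReal |h n i ω - 1|) P := fun i =>
    habs.comp_aemeasurable (H.h_law n i).aemeasurable
  have hwm : ∀ i, AEMeasurable (fun ω => w i fun j => x j ω) P := fun i =>
    ((hw i).comp hx).aemeasurable
  have hfw : ∀ i, AEMeasurable
      (fun ω => ENNReal.ofReal |h n i ω - 1| * w i fun j => x j ω) P := fun i => (hf i).mul (hwm i)
  have hint : ∫⁻ ω, ∑' i, ENNReal.ofReal |h n i ω - 1| * w i (fun j => x j ω) ∂P
      ≤ ENNReal.ofReal (√mI)⁻¹ * (b * K) := by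
    rw [lintegral_tsum hfw]
    have hterm : ∀ i, ∫⁻ ω, ENNReal.ofReal |h n i ω - 1| * w i (fun j => x j ω) ∂P
        ≤ ENNReal.ofReal (√mI)⁻¹ * ∫⁻ ω, w i (fun j => x j ω) ∂P := by
      intro i
      have hind : IndepFun (fun ω => ENNReal.ofReal |h n i ω - 1|)
          (fun ω => w i fun j => x j ω) P :=
        H.indep_locations.symm.comp (φ := fun p : (Fin N → ℝ) × (Fin N → ℕ → ℝ) => ENNReal.ofReal |p.2 n i - 1|)
          (habs.comp (by fun_prop)) (hw i)
      rw [lintegral_mul_eq_lintegral_mul_lintegral_of_indepFun'' (hf i) (hwm i) hind]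
      gcongr
      rw [(H.h_law n i).lintegral_comp (f := fun y => ENNReal.ofReal |y - 1|) habs.aemeasurable]
      exact lintegral_abs_sub_one_nakagamiGain_le hmI
    refine (ENNReal.tsum_le_tsum hterm).trans ?_
    rw [ENNReal.tsum_mul_left, ← lintegral_tsum hwm]
    gcongr
    calc ∫⁻ ω, ∑' i, w i (fun j => x j ω) ∂P ≤ ∫⁻ _, b * K ∂P := by
          refine lintegral_mono fun ω => ?_
          by_cases hω : (fun j => x j ω) ∈ {y : ℕ → Plane | ∑' j, ‖y j‖ₑ ^ (-α) ≤ K}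
          · simp only [w, Set.indicator_of_mem hω]
            rw [ENNReal.tsum_mul_left]
            gcongr
            exact hω
          · simp only [w, Set.indicator_of_notMem hω, tsum_zero, zero_le]
      _ = b * K := by simp
  have hsub : {ω | δ < deviation d α (fun i => x i ω) (fun i => h n i ω)}
      ⊆ (fun ω => ∑' i, ‖x i ω‖ₑ ^ (-α)) ⁻¹' Set.Ioi K
        ∪ {ω | δ ≤ ∑' i, ENNReal.ofReal |h n i ω - 1| * w i (fun j => x j ω)} := by
    intro ω hω
    by_cases hK : (fun j => x j ω) ∈ {y : ℕ → Plane | ∑' j, ‖y j‖ₑ ^ (-α) ≤ K}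
    · right
      refine (Set.mem_ofPred.1 hω).le.trans (le_of_eq ?_)
      simp only [w, Set.indicator_of_mem hK]
      rw [deviation, ← ENNReal.tsum_mul_left]
      exact tsum_congr fun i => mul_left_comm _ _ _
    · left
      simpa using hK
  refine (measure_mono hsub).trans ((measure_union_le _ _).trans ?_)
  rw [Measure.map_apply hSm measurableSet_Ioi]
  gcongr
  refine (meas_ge_le_lintegral_div (AEMeasurable.tsum hfw) hδ hδ').trans ?_
  gcongr

end IsNetwork

theorem tendsto_measure_Ioi_natCast {μ : Measure ℝ≥0∞} [IsFiniteMeasure μ]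
    (hμ : ∀ᵐ s ∂μ, s ≠ ∞) : Tendsto (fun k : ℕ => μ (Set.Ioi (k : ℝ≥0∞))) atTop (𝓝 0) := by
  have hinter : ⋂ k : ℕ, Set.Ioi (k : ℝ≥0∞) ⊆ {∞} := by
    intro s hs
    by_contra hne
    obtain ⟨k, hk⟩ := ENNReal.exists_nat_gt hne
    exact lt_asymm hk (Set.mem_iInter.1 hs k)
  have h0 : μ (⋂ k : ℕ, Set.Ioi (k : ℝ≥0∞)) = 0 :=
    measure_mono_null hinter (by simpa [ae_iff] using hμ)
  rw [← h0]
  exact tendsto_measure_iInter_atTop (fun _ => measurableSet_Ioi.nullMeasurableSet)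
    (fun a b hab => Set.Ioi_subset_Ioi (by exact_mod_cast hab)) ⟨0, measure_ne_top _ _⟩

/-! ### Passage to the limit. -/

section Limit

variable {Ω : ℝ → Type*} [∀ mI, MeasurableSpace (Ω mI)] {P : ∀ mI, Measure (Ω mI)}
  [∀ mI, IsProbabilityMeasure (P mI)] {N : ℕ} {lam mD : ℝ} {x : ∀ mI, ℕ → Ω mI → Plane}
  {g : ∀ mI, Fin N → Ω mI → ℝ} {h : ∀ mI, Fin N → ℕ → Ω mI → ℝ}

theorem tendsto_measure_exists_lt_deviation
    (H : ∀ mI, 0 < mI → IsNetwork (P mI) lam mD mI (x mI) (g mI) (h mI)) (d : ℝ) {α : ℝ}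
    {μ : Measure ℝ≥0∞} [IsProbabilityMeasure μ] (hμ : ∀ᵐ s ∂μ, s ≠ ∞)
    (hlaw : ∀ mI, 0 < mI → (P mI).map (fun ω => ∑' i, ‖x mI i ω‖ₑ ^ (-α)) = μ)
    {δ : ℝ≥0∞} (hδ : δ ≠ 0) (hδ' : δ ≠ ∞) :
    Tendsto (fun mI => P mI {ω | ∃ n, δ < deviation d α (fun i => x mI i ω)
      (fun i => h mI n i ω)}) atTop (𝓝 0) := by
  let b := ENNReal.ofReal (d ^ α)
  have hbound : ∀ (k : ℕ) (mI : ℝ), 0 < mI →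
      P mI {ω | ∃ n, δ < deviation d α (fun i => x mI i ω) (fun i => h mI n i ω)}
        ≤ N * (μ (Set.Ioi (k : ℝ≥0∞)) + ENNReal.ofReal (√mI)⁻¹ * (b * k) / δ) := by
    intro k mI hmI
    rw [Set.ofPred_exists]
    refine (measure_iUnion_fintype_le _ _).trans ?_
    refine (Finset.sum_le_sum fun n _ =>
      (H mI hmI).measure_lt_deviation_le hmI d α n hδ hδ' k).trans ?_
    rw [hlaw mI hmI]
    simp [b, mul_add]
  have hlim : ∀ k : ℕ, Tendsto (fun mI : ℝ => (N : ℝ≥0∞) * (μ (Set.Ioi (k : ℝ≥0∞))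
      + ENNReal.ofReal (√mI)⁻¹ * (b * k) / δ)) atTop (𝓝 (N * μ (Set.Ioi (k : ℝ≥0∞)))) := by
    intro k
    have h1 : Tendsto (fun mI : ℝ => ENNReal.ofReal (√mI)⁻¹) atTop (𝓝 0) := by
      rw [← ENNReal.ofReal_zero]
      exact ENNReal.tendsto_ofReal (tendsto_inv_atTop_zero.comp Real.tendsto_sqrt_atTop)
    have hbk : b * k ≠ ∞ := ENNReal.mul_ne_top ENNReal.ofReal_ne_top (ENNReal.natCast_ne_top k)
    have h2 := ENNReal.Tendsto.div_const (ENNReal.Tendsto.mul_const h1 (Or.inr hbk))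
      (b := δ) (Or.inr hδ)
    rw [zero_mul, ENNReal.zero_div] at h2
    have h3 := ENNReal.Tendsto.const_mul (a := (N : ℝ≥0∞))
      ((tendsto_const_nhds (x := μ (Set.Ioi (k : ℝ≥0∞)))).add h2)
      (Or.inr (ENNReal.natCast_ne_top N))
    simpa using h3
  have hk : Tendsto (fun k : ℕ => (N : ℝ≥0∞) * μ (Set.Ioi (k : ℝ≥0∞))) atTop (𝓝 0) := by
    have := ENNReal.Tendsto.const_mul (a := (N : ℝ≥0∞)) (tendsto_measure_Ioi_natCast hμ)
      (Or.inr (ENNReal.natCast_ne_top N))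
    simpa using this
  refine ENNReal.tendsto_nhds_zero.2 fun ε hε => ?_
  -- The truncation level is fixed first, to make the tail of `μ` small; only then does `mI` grow.
  obtain ⟨k, hkε⟩ := (hk.eventually (gt_mem_nhds hε)).exists
  filter_upwards [(hlim k).eventually (gt_mem_nhds hkε), eventually_gt_atTop 0] with mI h1 h2
  exact (hbound k mI h2).trans h1.le

theorem tendsto_successProb (hN : 1 ≤ N) {d α SNR T : ℝ} (hSNR : 0 < SNR) (hmD : 0 < mD)
    {μ : Measure ℝ≥0∞} [IsProbabilityMeasure μ] (hμ : ∀ᵐ s ∂μ, s ≠ ∞)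
    (H : ∀ mI, 0 < mI → IsNetwork (P mI) lam mD mI (x mI) (g mI) (h mI))
    (hg : ∀ mI, 0 < mI → iIndepFun (g mI) (P mI))
    (hlaw : ∀ mI, 0 < mI → (P mI).map (fun ω => ∑' i, ‖x mI i ω‖ₑ ^ (-α)) = μ) :
    Tendsto (fun mI => successProb (P mI) d α SNR T (x mI) (g mI) (h mI)) atTop
      (𝓝 (((totalGainLaw N mD).prod μ).real (successSet (ENNReal.ofReal (d ^ α))
        (ENNReal.ofReal T) (ENNReal.ofReal SNR⁻¹)))) := by
  have := isProbabilityMeasure_totalGainLaw N hmD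
  set b := ENNReal.ofReal (d ^ α)
  set t := ENNReal.ofReal T
  set c := ENNReal.ofReal SNR⁻¹ with hcdef
  have hc0 : c ≠ 0 := by simpa [c] using hSNR
  have hc : c ≠ ∞ := ENNReal.ofReal_ne_top
  have hcont := tendsto_prod_successSet hN hmD μ b (t := t) ENNReal.ofReal_ne_top c
  refine (ENNReal.tendsto_toReal (measure_ne_top _ _)).comp (tendsto_order.2 ⟨fun a ha => ?_,
    fun a ha => ?_⟩)
  -- Lower bound: by continuity a slightly larger noise `c'` still gives probability above `a`; the
  -- allowed deviation is `c' - c`.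
  · have := nhdsGT_neBot_of_exists_gt ⟨∞, hc.lt_top⟩
    obtain ⟨c', hc', hlt⟩ := (((hcont.mono_left nhdsWithin_le_nhds).eventually (lt_mem_nhds ha)).and
      (Ioo_mem_nhdsGT hc.lt_top)).exists
    have hδ : c' - c ≠ 0 := (tsub_pos_of_lt hlt.1).ne'
    have hδ' : c' - c ≠ ∞ := (lt_of_le_of_lt tsub_le_self hlt.2).ne
    have herr := tendsto_measure_exists_lt_deviation H d hμ hlaw hδ hδ'
    have hsub := ENNReal.Tendsto.sub (tendsto_const_nhds
      (x := ((totalGainLaw N mD).prod μ) (successSet b t c'))) herr (Or.inr ENNReal.zero_ne_top)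
    rw [tsub_zero] at hsub
    filter_upwards [hsub.eventually (lt_mem_nhds hc'), eventually_gt_atTop 0] with mI h1 h2
    refine h1.trans_le (tsub_le_iff_right.2 ?_)
    rw [← hlaw mI h2, ← (H mI h2).measure_mem_successSet (hg mI h2)]
    refine (measure_mono fun ω hω => ?_).trans (measure_union_le _ _)
    by_cases hD : ∃ n, c' - c < deviation d α (fun i => x mI i ω) (fun i => h mI n i ω)
    · exact Or.inr hD
    · left
      push Not at hD
      exact le_sinr_of_mem_successSet (add_tsub_cancel_of_le hlt.1.le).symm
        (hc0.bot_lt.trans hlt.1).ne' hD hω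
  -- Upper bound, with a slightly smaller noise `c'`; room below `c` exists because the noise is
  -- positive.
  · have := nhdsLT_neBot_of_exists_lt ⟨0, hc0.bot_lt⟩
    obtain ⟨c', hc', hlt⟩ := (((hcont.mono_left nhdsWithin_le_nhds).eventually (gt_mem_nhds ha)).and
      (Ioo_mem_nhdsLT hc0.bot_lt)).exists
    have hδ : c - c' ≠ 0 := (tsub_pos_of_lt hlt.2).ne'
    have hδ' : c - c' ≠ ∞ := (lt_of_le_of_lt tsub_le_self hc.lt_top).ne
    have herr := tendsto_measure_exists_lt_deviation H d hμ hlaw hδ hδ'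
    have hadd := (tendsto_const_nhds
      (x := ((totalGainLaw N mD).prod μ) (successSet b t c'))).add herr
    rw [add_zero] at hadd
    filter_upwards [hadd.eventually (gt_mem_nhds hc'), eventually_gt_atTop 0] with mI h1 h2
    refine lt_of_le_of_lt ?_ h1
    rw [← hlaw mI h2, ← (H mI h2).measure_mem_successSet (hg mI h2)]
    refine (measure_mono fun ω hω => ?_).trans (measure_union_le _ _)
    by_cases hD : ∃ n, c - c' < deviation d α (fun i => x mI i ω) (fun i => h mI n i ω)
    · exact Or.inr hD
    · left
      push Not at hD
      exact mem_successSet_of_le_sinr (add_tsub_cancel_of_le hlt.2.le).symm hD hω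

end Limit

-- One path-loss law for all realizations, and the conclusion.

universe u v

/-- The law of `∑ᵢ ‖xᵢ‖ ^ (-α)` over the points of a Poisson process is almost surely finite and
depends only on the density. -/
theorem exists_pathLossLaw (lam : ℝ) {α : ℝ} (hα : 2 < α) :
    ∃ μ : Measure ℝ≥0∞, IsProbabilityMeasure μ ∧ (∀ᵐ s ∂μ, s ≠ ∞) ∧
      (∀ (Ω : Type u) [MeasurableSpace Ω] (P : Measure Ω) [IsProbabilityMeasure P]
        (x : ℕ → Ω → Plane), IsPoissonProcess P lam x →
        P.map (fun ω => ∑' i, ‖x i ω‖ₑ ^ (-α)) = μ) ∧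
      (∀ (Ω : Type v) [MeasurableSpace Ω] (P : Measure Ω) [IsProbabilityMeasure P]
        (x : ℕ → Ω → Plane), IsPoissonProcess P lam x →
        P.map (fun ω => ∑' i, ‖x i ω‖ₑ ^ (-α)) = μ) := by
  have hmeas := measurable_enorm_rpow α
  -- The two models may live in different universes but must share `μ`, so it is read off from any
  -- process found in either one.
  by_cases hu : ∃ (Ω : Type u) (_ : MeasurableSpace Ω) (P : Measure Ω) (_ : IsProbabilityMeasure P)
      (x : ℕ → Ω → Plane), IsPoissonProcess P lam x
  · obtain ⟨Ω, _, P, _, x, hx⟩ := hu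
    refine ⟨P.map fun ω => ∑' i, ‖x i ω‖ₑ ^ (-α),
      Measure.isProbabilityMeasure_map (hx.measurable_tsum hmeas).aemeasurable, ?_,
      fun Ω' _ P' _ x' hx' => hx'.map_tsum_eq hx hmeas,
      fun Ω' _ P' _ x' hx' => hx'.map_tsum_eq hx hmeas⟩
    exact (ae_map_iff (hx.measurable_tsum hmeas).aemeasurable (by measurability)).2
      (hx.ae_tsum_enorm_rpow_ne_top hα)
  by_cases hv : ∃ (Ω : Type v) (_ : MeasurableSpace Ω) (P : Measure Ω) (_ : IsProbabilityMeasure P)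
      (x : ℕ → Ω → Plane), IsPoissonProcess P lam x
  · obtain ⟨Ω, _, P, _, x, hx⟩ := hv
    refine ⟨P.map fun ω => ∑' i, ‖x i ω‖ₑ ^ (-α),
      Measure.isProbabilityMeasure_map (hx.measurable_tsum hmeas).aemeasurable, ?_,
      fun Ω' _ P' _ x' hx' => hx'.map_tsum_eq hx hmeas,
      fun Ω' _ P' _ x' hx' => hx'.map_tsum_eq hx hmeas⟩
    exact (ae_map_iff (hx.measurable_tsum hmeas).aemeasurable (by measurability)).2
      (hx.ae_tsum_enorm_rpow_ne_top hα)
  -- Without a Poisson process in either universe both uniqueness claims are vacuous, and any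
  -- finite-valued law serves.
  · exact ⟨Measure.dirac 0, inferInstance, by simp [ae_dirac_eq],
      fun Ω _ P hP x hx => absurd ⟨Ω, _, P, hP, x, hx⟩ hu,
      fun Ω _ P hP x hx => absurd ⟨Ω, _, P, hP, x, hx⟩ hv⟩

end MRC

theorem mainTheorem3 (N : ℕ) (hN : 1 ≤ N) (lam d α SNR T : ℝ) (hlam : 0 < lam) (hd : 0 < d)
    (hα : 2 < α) (hSNR : 0 < SNR) (hT : 0 < T) (mD : ℕ) (hmD : 1 ≤ mD) :
    ∃ L : ℝ, 0 < L ∧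
      (∀ (Ω : ℝ → Type*) [∀ mI, MeasurableSpace (Ω mI)] (P : ∀ mI, Measure (Ω mI))
        [∀ mI, IsProbabilityMeasure (P mI)] (x : ∀ mI, ℕ → Ω mI → MRC.Plane)
        (g : ∀ mI, Fin N → Ω mI → ℝ) (h : ∀ mI, Fin N → ℕ → Ω mI → ℝ),
        (∀ mI, 0 < mI → MRC.IsExactModel (P mI) lam mD mI (x mI) (g mI) (h mI)) →
        Tendsto (fun mI => MRC.successProb (P mI) d α SNR T (x mI) (g mI) (h mI))
          atTop (𝓝 L)) ∧
      (∀ (Ω : ℝ → Type*) [∀ mI, MeasurableSpace (Ω mI)] (P : ∀ mI, Measure (Ω mI))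
        [∀ mI, IsProbabilityMeasure (P mI)] (x : ∀ mI, ℕ → Ω mI → MRC.Plane)
        (g : ∀ mI, Fin N → Ω mI → ℝ) (h : ∀ mI, Fin N → ℕ → Ω mI → ℝ),
        (∀ mI, 0 < mI → MRC.IsFCModel (P mI) lam mD mI (x mI) (g mI) (h mI)) →
        Tendsto (fun mI => MRC.successProb (P mI) d α SNR T (x mI) (g mI) (h mI))
          atTop (𝓝 L)) := by
  obtain ⟨μ, _, hμ, hu, hv⟩ := MRC.exists_pathLossLaw lam hα
  have hmD' : (0 : ℝ) < mD := by exact_mod_cast hmD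
  have := MRC.isProbabilityMeasure_totalGainLaw N hmD'
  refine ⟨((MRC.totalGainLaw N mD).prod μ).real (MRC.successSet (ENNReal.ofReal (d ^ α))
    (ENNReal.ofReal T) (ENNReal.ofReal SNR⁻¹)), ?_, ?_, ?_⟩
  · exact ENNReal.toReal_pos (MRC.prod_successSet_pos hN hmD' μ hμ ENNReal.ofReal_ne_top
      ENNReal.ofReal_ne_top ENNReal.ofReal_ne_top).ne' (measure_ne_top _ _)
  · intro Ω _ P _ x g h H
    exact MRC.tendsto_successProb hN hSNR hmD' hμ (fun mI hm => (H mI hm).toIsNetwork)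
      (fun mI hm => iIndepFun.precomp (g := Sum.inl) Sum.inl_injective (H mI hm).indep_gains)
      (fun mI hm => hu _ _ _ (H mI hm).poisson)
  · intro Ω _ P _ x g h H
    exact MRC.tendsto_successProb hN hSNR hmD' hμ (fun mI hm => (H mI hm).toIsNetwork)
      (fun mI hm => iIndepFun.precomp (g := Sum.inl) Sum.inl_injective
        ((H mI hm).indep_gains ⟨0, hN⟩))
      (fun mI hm => hv _ _ _ (H mI hm).poisson)
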